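/- Let $\mathcal H$ be a real Hilbert space and let $A,B:\mathcal H\to 2^{\mathcal H}$ be maximally monotone operators with $\operatorname{Zer}(A+B)=\{x\in\mathcal H: 0\in Ax+Bx\}\neq\emptyset$. For a maximally monotone operator $M$ let $J_M=(\mathrm{Id}+M)^{-1}$ be its resolvent (a single-valued map defined on all of $\mathcal H$), and let $R_M=2J_M-\mathrm{Id}$. Let $\gamma>0$, and let $(e_n)_{n\ge 0}$ and $(\theta_n)_{n\ge 0}$ be real sequences such that (a) $0<e_n<1$ for all $n\ge 0$, $\lim_{n\to\infty}e_n=1$, $\sum_{n\ge 0}(1-e_n)=\infty$ and $\sum_{n\ge 1}|e_n-e_{n-1}|<\infty$; (b) there are constants $\underline\Theta,\overline\Theta$ with $0<\underline\Theta\le \theta_n/2\le\overline\Theta<1$ for all $n\ge 0$, and $\sum_{n\ge 1}|\theta_n-\theta_{n-1}|<\infty$. Let $x_0\in\mathcal H$ be arbitrary, and for all $n\ge 0$ let $$y_n=J_{\gamma B}(e_nx_n),\qquad z_n=J_{\gamma A}(2y_n-e_nx_n),\qquad u_n=e_nx_n+\theta_n(z_n-y_n),\qquad x_{n+1}=R_{\gamma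 A}R_{\gamma B}u_n .$$ Then the point $\bar x=\operatorname{proj}_{\operatorname{Fix}(R_{\gamma A}R_{\gamma B})}(0)$, that is, the element of minimal norm of $\operatorname{Fix}(R_{\gamma A}R_{\gamma B})$, exists and is unique, and (i) $(x_n)$ converges strongly to $\bar x$; (ii) $(y_n)$ and $(z_n)$ converge strongly to $J_{\gamma B}(\bar x)$, and $J_{\gamma B}(\bar x)\in\operatorname{Zer}(A+B)$. -/

import Mathlib

open Filter Topology
open scoped Pointwise

/-- Set-valued operators `H → 2^H`. Sums `A + B` and multiples `γ • A` are the pointwise ones: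
`(A + B) x = A x + B x` (Minkowski sum) and `(γ • A) x = {γ • u | u ∈ A x}`. -/
abbrev SetOp (H : Type*) := H → Set H

namespace SetOp

variable {H : Type*} [NormedAddCommGroup H] [InnerProductSpace ℝ H]

/-- The graph of a set-valued operator. -/
def graph (A : SetOp H) : Set (H × H) := {p | p.2 ∈ A p.1}

/-- Monotone set-valued operators. -/
def IsMonotone (A : SetOp H) : Prop :=
  ∀ p ∈ graph A, ∀ q ∈ graph A, 0 ≤ inner ℝ (p.1 - q.1) (p.2 - q.2)

/-- Maximally monotone operators: monotone, and no monotone operator has a strictly larger graph. -/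
def IsMaximallyMonotone (A : SetOp H) : Prop :=
  IsMonotone A ∧ ¬ ∃ B : SetOp H, IsMonotone B ∧ graph A ⊂ graph B

/-- The set of zeros of an operator. -/
def zer (A : SetOp H) : Set H := {x | (0 : H) ∈ A x}

/-- The identity, as a set-valued operator. -/
def idOp : SetOp H := fun x => {x}

/-- The inverse of a set-valued operator. -/
def inv (A : SetOp H) : SetOp H := fun u => {x | u ∈ A x}

/-- The resolvent `(Id + A)⁻¹` as a set-valued operator. -/
def resolventOp (A : SetOp H) : SetOp H := inv (idOp + A)

open Classical in
/-- The resolvent `J_A = (Id + A)⁻¹` as a map `H → H`: the element of `(Id + A)⁻¹ w`. For a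
maximally monotone operator `A` on a Hilbert space the set `(Id + A)⁻¹ w` has exactly one element
for every `w`; the value `0` is used only where that set is empty. -/
noncomputable def resolvent (A : SetOp H) (w : H) : H :=
  if h : (resolventOp A w).Nonempty then h.some else 0

/-- The reflected resolvent `R_A = 2 J_A - Id`. -/
noncomputable def reflectedResolvent (A : SetOp H) (w : H) : H := (2 : ℝ) • resolvent A w - w

/-- The projection of `x` on `C`: the set of points of `C` at minimal distance from `x`. -/
def proj (C : Set H) (x : H) : Set H := {p | p ∈ C ∧ ∀ z ∈ C, ‖x - p‖ ≤ ‖x - z‖}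

end SetOp

/-! Write `T = R_{γA} R_{γB}` and `w n = e n • x n`. Then `T` is nonexpansive and `T (w n) - w n = 2
(z n - y n)`, so the scheme is `x (n + 1) = T (w n + (θ n / 2) • (T (w n) - w n))`. The factor `e n`
pulls toward 0; the pull fades, but as `∑ (1 - e n)` diverges it still selects the fixed point `q`
of least norm. This is `tendsto_of_regularized_iteration`. Bounded variation of the parameters makes
successive iterates merge; the loss `l (1 - l) ‖T w - w‖²` in each relaxed step then forces `T (w n)
- w n → 0`; finally `‖x n - q‖²` satisfies the recursion of `tendsto_zero_of_le_one_sub_mul_add`,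
given `limsup ⟪q, q - w n⟫ ≤ 0`. No weak compactness is used: `q` is the strong limit of Browder's
path, and the limsup bound comes from comparing `w n` with that path through monotonicity of `Id -
T`. Resolvents are everywhere defined by Minty's theorem, obtained by minimizing the Fitzpatrick
function plus half the squared norms. -/

namespace SetOp

variable {H : Type*} [NormedAddCommGroup H] [InnerProductSpace ℝ H]

/-! ### Minty's theorem -/

/-- A point monotonically related to the graph of a maximally monotone operator lies on it. -/
lemma IsMaximallyMonotone.mem_of_forall {A : SetOp H} (hA : A.IsMaximallyMonotone) {x u : H}
    (h : ∀ a, ∀ b ∈ A a, 0 ≤ inner ℝ (x - a) (u - b)) : u ∈ A x := by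
  by_contra hxu
  refine hA.2 ⟨fun a => {b | b ∈ A a ∨ (a = x ∧ b = u)}, ?_, ?_⟩
  · rintro ⟨a, b⟩ hp ⟨c, d⟩ hq
    rcases hp with hp | ⟨h1, h2⟩ <;> rcases hq with hq | ⟨h3, h4⟩
    · exact hA.1 (a, b) hp (c, d) hq
    · simp only at h3 h4 ⊢
      rw [h3, h4, ← neg_sub x a, ← neg_sub u b, inner_neg_neg]
      exact h a b hp
    · simp only at h1 h2 ⊢
      rw [h1, h2]
      exact h c d hq
    · simp only at h1 h2 h3 h4 ⊢
      simp [h1, h2, h3, h4]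
  · refine ⟨fun p hp => Or.inl hp, fun hsub => hxu ?_⟩
    exact @hsub (x, u) (Or.inr ⟨rfl, rfl⟩)

lemma IsMonotone.inner_nonneg {A : SetOp H} (hA : A.IsMonotone) {x y u v : H}
    (hu : u ∈ A x) (hv : v ∈ A y) : 0 ≤ inner ℝ (x - y) (u - v) :=
  hA (x, u) hu (y, v) hv

/-- The affine forms whose supremum is the Fitzpatrick function, along a segment. -/
lemma fitzpatrick_form_segment_le {x u x' u' a b : H} {r r' : ℝ}
    (h : inner ℝ x b + inner ℝ a u - inner ℝ a b ≤ r)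
    (h' : inner ℝ x' b + inner ℝ a u' - inner ℝ a b ≤ r') (t : ℝ) (h0 : 0 ≤ t) (h1 : t ≤ 1) :
    inner ℝ (x + t • (x' - x)) b + inner ℝ a (u + t • (u' - u)) - inner ℝ a b
      ≤ r + t * (r' - r) := by
  simp only [inner_add_left, inner_add_right, inner_sub_left, inner_sub_right,
    real_inner_smul_left, real_inner_smul_right]
  nlinarith [mul_le_mul_of_nonneg_left h (sub_nonneg.2 h1), mul_le_mul_of_nonneg_left h' h0]

lemma norm_sq_add_smul_sub (x y : H) (t : ℝ) :
    ‖x + t • (y - x)‖ ^ 2 = (1 - t) * ‖x‖ ^ 2 + t * ‖y‖ ^ 2 - t * (1 - t) * ‖y - x‖ ^ 2 := by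
  simp only [← real_inner_self_eq_norm_sq, inner_add_left, inner_add_right, inner_sub_left,
    inner_sub_right, real_inner_smul_left, real_inner_smul_right, real_inner_comm x y]
  ring

/-- On a nonempty closed convex `C`, an epigraph of a function bounded below by the duality pairing
(such as the Fitzpatrick function), the regularized height attains its minimum. -/
lemma exists_min_fitzpatrick [CompleteSpace H] (C : H → H → ℝ → Prop)
    (hne : ∃ x u r, C x u r)
    (hconv : ∀ x u r x' u' r' t, 0 ≤ t → t ≤ 1 → C x u r → C x' u' r' →
      C (x + t • (x' - x)) (u + t • (u' - u)) (r + t * (r' - r)))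
    (hclosed : ∀ (x u : ℕ → H) (r : ℕ → ℝ) x' u' r', Tendsto x atTop (𝓝 x') →
      Tendsto u atTop (𝓝 u') → Tendsto r atTop (𝓝 r') → (∀ n, C (x n) (u n) (r n)) → C x' u' r')
    (hbdd : ∀ x u r, C x u r → inner ℝ x u ≤ r) :
    ∃ x u r, C x u r ∧ ∀ x' u' r', C x' u' r' →
      r + ‖x‖ ^ 2 / 2 + ‖u‖ ^ 2 / 2 ≤ r' + ‖x'‖ ^ 2 / 2 + ‖u'‖ ^ 2 / 2 := by
  set S : Set ℝ := {v | ∃ x u r, C x u r ∧ r + ‖x‖ ^ 2 / 2 + ‖u‖ ^ 2 / 2 = v} with hS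
  have hSne : S.Nonempty := by
    obtain ⟨x, u, r, h⟩ := hne
    exact ⟨_, x, u, r, h, rfl⟩
  have hSb : BddBelow S := by
    refine ⟨0, ?_⟩
    rintro v ⟨x, u, r, h, rfl⟩
    have h1 := hbdd x u r h
    have h2 := norm_add_sq_real x u
    nlinarith [sq_nonneg ‖x + u‖]
  set m := sInf S with hm
  have hlow : ∀ x u r, C x u r → m ≤ r + ‖x‖ ^ 2 / 2 + ‖u‖ ^ 2 / 2 := fun x u r h =>
    csInf_le hSb ⟨x, u, r, h, rfl⟩
  have hex : ∀ n : ℕ, ∃ x u r, C x u r ∧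
      r + ‖x‖ ^ 2 / 2 + ‖u‖ ^ 2 / 2 < m + 1 / ((n : ℝ) + 1) := by
    intro n
    obtain ⟨v, ⟨x, u, r, h, rfl⟩, hv⟩ := exists_lt_of_csInf_lt hSne
      (show sInf S < m + 1 / ((n : ℝ) + 1) from lt_add_of_pos_right _ Nat.one_div_pos_of_nat)
    exact ⟨x, u, r, h, hv⟩
  choose x u r hC hlt using hex
  -- Strong convexity at midpoints: the quadratic part gains one eighth of the squared distance, so
  -- minimizing sequences are Cauchy.
  have hdist : ∀ N n k, N ≤ n → N ≤ k →
      ‖x n - x k‖ ^ 2 + ‖u n - u k‖ ^ 2 ≤ 8 * (1 / ((N : ℝ) + 1)) := by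
    intro N n k hn hk
    have h1 := hlow _ _ _ (hconv _ _ _ _ _ _ (1 / 2) (by norm_num) (by norm_num) (hC k) (hC n))
    rw [norm_sq_add_smul_sub, norm_sq_add_smul_sub] at h1
    have h2 := hlt n
    have h3 := hlt k
    have h4 : 1 / ((n : ℝ) + 1) ≤ 1 / ((N : ℝ) + 1) := Nat.one_div_le_one_div hn
    have h5 : 1 / ((k : ℝ) + 1) ≤ 1 / ((N : ℝ) + 1) := Nat.one_div_le_one_div hk
    linarith
  have hzero : Tendsto (fun N : ℕ => √(8 * (1 / ((N : ℝ) + 1)))) atTop (𝓝 0) := by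
    have := ((tendsto_one_div_add_atTop_nhds_zero_nat (𝕜 := ℝ)).const_mul 8).sqrt
    simpa using this
  have hcx : CauchySeq x := by
    refine cauchySeq_of_le_tendsto_0 _ (fun n k N hn hk => ?_) hzero
    rw [dist_eq_norm]
    exact Real.le_sqrt_of_sq_le (by nlinarith [hdist N n k hn hk, sq_nonneg ‖u n - u k‖])
  have hcu : CauchySeq u := by
    refine cauchySeq_of_le_tendsto_0 _ (fun n k N hn hk => ?_) hzero
    rw [dist_eq_norm]
    exact Real.le_sqrt_of_sq_le (by nlinarith [hdist N n k hn hk, sq_nonneg ‖x n - x k‖])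
  obtain ⟨x', hx'⟩ := cauchySeq_tendsto_of_complete hcx
  obtain ⟨u', hu'⟩ := cauchySeq_tendsto_of_complete hcu
  have hval : Tendsto (fun n => r n + ‖x n‖ ^ 2 / 2 + ‖u n‖ ^ 2 / 2) atTop (𝓝 m) := by
    refine tendsto_of_tendsto_of_tendsto_of_le_of_le tendsto_const_nhds
      (h := fun n : ℕ => m + 1 / ((n : ℝ) + 1)) ?_ (fun n => hlow _ _ _ (hC n))
      (fun n => (hlt n).le)
    simpa using (tendsto_one_div_add_atTop_nhds_zero_nat (𝕜 := ℝ)).const_add m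
  have hr : Tendsto r atTop (𝓝 (m - ‖x'‖ ^ 2 / 2 - ‖u'‖ ^ 2 / 2)) := by
    have := (hval.sub ((hx'.norm.pow 2).div_const 2)).sub ((hu'.norm.pow 2).div_const 2)
    refine this.congr fun n => ?_
    ring
  refine ⟨x', u', _, hclosed x u r _ _ _ hx' hu' hr hC, fun a b c h => ?_⟩
  have := hlow a b c h
  linarith

/-- Minty's theorem at the origin, for the graph `G` of a maximally monotone operator. -/
lemma minty_zero [CompleteSpace H] (G : SetOp H) (hmono : G.IsMonotone)
    (hmax : ∀ x u, (∀ a, ∀ b ∈ G a, 0 ≤ inner ℝ (x - a) (u - b)) → u ∈ G x) :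
    ∃ x, -x ∈ G x := by
  have hbdd : ∀ x u r, (∀ a, ∀ b ∈ G a, inner ℝ x b + inner ℝ a u - inner ℝ a b ≤ r) →
      inner ℝ x u ≤ r := by
    intro x u r hC
    -- Were `r` below the pairing, `(x, u)` would be monotonically related to `G`, hence in it, and
    -- its own affine form would contradict `r`.
    by_contra hlt
    push Not at hlt
    have hmem : u ∈ G x := hmax _ _ fun a b hab => by
      have := hC a b hab
      simp only [inner_sub_left, inner_sub_right]
      linarith
    have := hC x u hmem
    linarith
  have hattain := exists_min_fitzpatrick
    (fun x u r => ∀ a, ∀ b ∈ G a, inner ℝ x b + inner ℝ a u - inner ℝ a b ≤ r) ?_ ?_ ?_ hbdd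
  · obtain ⟨x, u, r, hC, hmin⟩ := hattain
    have hxu : inner ℝ x u ≤ r := hbdd x u r hC
    have key : ∀ a, ∀ b ∈ G a, ‖x + u‖ ^ 2 ≤ inner ℝ (-u - a) (-x - b) := by
      intro a b hab
      set D := ‖a - x‖ ^ 2 + ‖b - u‖ ^ 2 with hD
      set L := inner ℝ a b - r + inner ℝ x (a - x) + inner ℝ u (b - u) with hL
      -- First-order optimality toward a graph point, where the Fitzpatrick function is at most `⟪a,
      -- b⟫`.
      have hLt : ∀ t : ℝ, 0 < t → t ≤ 1 → 0 ≤ L + t * (D / 2) := by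
        intro t h0 h1
        have h2 := hmin (x + t • (a - x)) (u + t • (b - u)) (r + t * (inner ℝ a b - r))
          (fun c d hcd => fitzpatrick_form_segment_le (hC c d hcd) (by
            have := hmono.inner_nonneg hab hcd
            simp only [inner_sub_left, inner_sub_right] at this
            linarith) t h0.le h1)
        rw [norm_add_sq_real, norm_add_sq_real, norm_smul, norm_smul, mul_pow, mul_pow,
          real_inner_smul_right, real_inner_smul_right, Real.norm_eq_abs, sq_abs] at h2
        have h3 : 0 ≤ t * (L + t * (D / 2)) := by
          rw [hL, hD]
          linarith
        exact nonneg_of_mul_nonneg_right h3 h0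
      have hL0 : 0 ≤ L := by
        have hlim : Tendsto (fun t : ℝ => L + t * (D / 2)) (𝓝[>] 0) (𝓝 L) := by
          have : Continuous fun t : ℝ => L + t * (D / 2) := by fun_prop
          simpa using (this.tendsto 0).mono_left nhdsWithin_le_nhds
        refine ge_of_tendsto hlim ?_
        filter_upwards [Ioc_mem_nhdsGT (zero_lt_one' ℝ)] with t ht
        exact hLt t ht.1 ht.2
      rw [hL] at hL0
      rw [norm_add_sq_real, ← real_inner_self_eq_norm_sq, ← real_inner_self_eq_norm_sq]
      simp only [inner_sub_left, inner_sub_right, inner_neg_left, inner_neg_right,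
        real_inner_comm x u, real_inner_comm x a] at hL0 ⊢
      linarith
    -- The bound `key` can now be tested at `(-u, -x)` itself, which forces `x + u = 0`.
    have hmem : -x ∈ G (-u) := hmax _ _ fun a b hab => (sq_nonneg _).trans (key a b hab)
    have h0 := key _ _ hmem
    rw [sub_self, inner_zero_left] at h0
    have hux : -u = x := by
      have h1 : ‖x + u‖ = 0 := by nlinarith [norm_nonneg (x + u)]
      exact (eq_neg_of_add_eq_zero_left (norm_eq_zero.1 h1)).symm
    exact ⟨x, by rwa [hux] at hmem⟩
  · by_cases h : ∃ a b, b ∈ G a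
    · obtain ⟨a, b, hab⟩ := h
      refine ⟨a, b, inner ℝ a b, fun c d hcd => ?_⟩
      have := hmono.inner_nonneg hab hcd
      simp only [inner_sub_left, inner_sub_right] at this
      linarith
    · push Not at h
      -- An empty graph is not maximal: every point is vacuously related to it.
      exact absurd (hmax 0 0 fun a b hab => absurd hab (h a b)) (h 0 0)
  · intro x u r x' u' r' t h0 h1 h h' a b hab
    exact fitzpatrick_form_segment_le (h a b hab) (h' a b hab) t h0 h1
  · intro x u r x' u' r' hx hu hr h a b hab
    refine le_of_tendsto_of_tendsto' (((hx.inner tendsto_const_nhds).add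
      (tendsto_const_nhds.inner hu)).sub tendsto_const_nhds) hr fun n => h n a b hab

/-! ### Resolvents and reflected resolvents -/

omit [InnerProductSpace ℝ H] in
lemma mem_resolventOp_iff {A : SetOp H} {w x : H} : x ∈ resolventOp A w ↔ w - x ∈ A x := by
  change w ∈ ({x} : Set H) + A x ↔ _
  rw [Set.singleton_add, Set.mem_image]
  constructor
  · rintro ⟨v, hv, rfl⟩
    simpa using hv
  · intro h
    exact ⟨_, h, by abel⟩

/-- **Minty's theorem**: `Id + A` is surjective for a maximally monotone `A`. -/
theorem IsMaximallyMonotone.resolventOp_nonempty [CompleteSpace H] {A : SetOp H}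
    (hA : A.IsMaximallyMonotone) (w : H) : (resolventOp A w).Nonempty := by
  -- Translating the values by `-w` reduces the claim to the case of the origin.
  obtain ⟨x, hx⟩ := minty_zero (fun x => {v | v + w ∈ A x})
    (fun p hp q hq => by
      have := hA.1.inner_nonneg hp hq
      rwa [add_sub_add_right_eq_sub] at this)
    (fun x u h => hA.mem_of_forall fun a b hab => by
      have := h a (b - w) (by simpa using hab)
      rwa [← sub_add, sub_add_eq_add_sub] at this)
  refine ⟨x, mem_resolventOp_iff.2 ?_⟩
  rwa [sub_eq_neg_add]

lemma IsMaximallyMonotone.sub_resolvent_mem [CompleteSpace H] {A : SetOp H}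
    (hA : A.IsMaximallyMonotone) (w : H) : w - resolvent A w ∈ A (resolvent A w) := by
  rw [← mem_resolventOp_iff, resolvent, dif_pos (hA.resolventOp_nonempty w)]
  exact (hA.resolventOp_nonempty w).some_mem

/-- Monotonicity makes the cross term nonnegative. This yields both uniqueness of resolvent points
and nonexpansiveness. -/
lemma IsMonotone.norm_le_norm_add_sub_add {A : SetOp H} (hA : A.IsMonotone) {x y u v : H}
    (hu : u ∈ A x) (hv : v ∈ A y) : ‖x - y‖ ≤ ‖(x + u) - (y + v)‖ := by
  have h := hA.inner_nonneg hu hv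
  rw [add_sub_add_comm]
  refine le_of_sq_le_sq ?_ (norm_nonneg _)
  rw [norm_add_sq_real]
  nlinarith [sq_nonneg ‖u - v‖]

lemma IsMaximallyMonotone.resolvent_eq [CompleteSpace H] {A : SetOp H}
    (hA : A.IsMaximallyMonotone) {w x : H} (h : w - x ∈ A x) : resolvent A w = x := by
  have := hA.1.norm_le_norm_add_sub_add (hA.sub_resolvent_mem w) h
  simpa [sub_eq_zero] using this

lemma IsMaximallyMonotone.norm_resolvent_sub_le [CompleteSpace H] {A : SetOp H}
    (hA : A.IsMaximallyMonotone) (w w' : H) : ‖resolvent A w - resolvent A w'‖ ≤ ‖w - w'‖ := by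
  simpa using hA.1.norm_le_norm_add_sub_add (hA.sub_resolvent_mem w) (hA.sub_resolvent_mem w')

lemma IsMaximallyMonotone.continuous_resolvent [CompleteSpace H] {A : SetOp H}
    (hA : A.IsMaximallyMonotone) : Continuous (resolvent A) :=
  (LipschitzWith.of_dist_le_mul (K := 1) fun x y => by
    simpa [dist_eq_norm] using hA.norm_resolvent_sub_le x y).continuous

/-- Inputs differ by `P + Q` and outputs by `P - Q`, where `⟪P, Q⟫ ≥ 0`. -/
lemma IsMaximallyMonotone.norm_reflectedResolvent_sub_le [CompleteSpace H] {A : SetOp H}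
    (hA : A.IsMaximallyMonotone) (w w' : H) :
    ‖reflectedResolvent A w - reflectedResolvent A w'‖ ≤ ‖w - w'‖ := by
  have h := hA.1.inner_nonneg (hA.sub_resolvent_mem w) (hA.sub_resolvent_mem w')
  set p := resolvent A w with hp
  set q := resolvent A w' with hq
  have e1 : reflectedResolvent A w - reflectedResolvent A w' = (p - q) - ((w - p) - (w' - q)) := by
    rw [reflectedResolvent, reflectedResolvent, two_smul, two_smul]
    abel
  have e2 : w - w' = (p - q) + ((w - p) - (w' - q)) := by abel
  rw [e1, e2]
  refine le_of_sq_le_sq ?_ (norm_nonneg _)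
  rw [norm_add_sq_real, norm_sub_sq_real]
  linarith

lemma mem_smul_iff {A : SetOp H} {γ : ℝ} (hγ : 0 < γ) {x v : H} :
    v ∈ (γ • A) x ↔ γ⁻¹ • v ∈ A x :=
  Set.mem_smul_set_iff_inv_smul_mem₀ hγ.ne' (A x) v

lemma IsMonotone.smul {A : SetOp H} (hA : A.IsMonotone) {γ : ℝ} (hγ : 0 < γ) :
    (γ • A).IsMonotone := fun p hp q hq => by
  have := hA.inner_nonneg ((mem_smul_iff hγ).1 hp) ((mem_smul_iff hγ).1 hq)
  rw [← smul_sub, real_inner_smul_right] at this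
  exact nonneg_of_mul_nonneg_right this (inv_pos.2 hγ)

lemma IsMaximallyMonotone.smul {A : SetOp H} (hA : A.IsMaximallyMonotone) {γ : ℝ} (hγ : 0 < γ) :
    (γ • A).IsMaximallyMonotone := by
  refine ⟨hA.1.smul hγ, ?_⟩
  rintro ⟨B, hB, hsub, hne⟩
  refine hne fun p hp => (mem_smul_iff hγ).2 (hA.mem_of_forall fun a b hab => ?_)
  have hmem : γ • b ∈ B a := @hsub (a, γ • b) (Set.smul_mem_smul_set hab)
  have := hB.inner_nonneg hp hmem
  have e1 : γ⁻¹ • p.2 - b = γ⁻¹ • (p.2 - γ • b) := by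
    rw [smul_sub, inv_smul_smul₀ hγ.ne']
  rw [e1, real_inner_smul_right]
  exact mul_nonneg (inv_pos.2 hγ).le this

end SetOp

/-! ### A recursive inequality for real sequences -/

/-- Xu's lemma on sequences with `a (n + 1) ≤ (1 - α n) * a n + α n * β n + c n`. -/
lemma tendsto_zero_of_le_one_sub_mul_add {a α β c : ℕ → ℝ} (ha : ∀ n, 0 ≤ a n)
    (hα : ∀ n, 0 ≤ α n ∧ α n ≤ 1)
    (hdiv : Tendsto (fun N => ∑ n ∈ Finset.range N, α n) atTop atTop)
    (hβ : ∀ ε > 0, ∀ᶠ n in atTop, β n ≤ ε) (hc0 : ∀ n, 0 ≤ c n) (hc : Summable c)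
    (h : ∀ n, a (n + 1) ≤ (1 - α n) * a n + α n * β n + c n) :
    Tendsto a atTop (𝓝 0) := by
  rw [Metric.tendsto_atTop]
  intro ε hε
  set S : ℕ → ℝ := fun n => ∑ k ∈ Finset.range n, c k with hS
  set D : ℕ → ℝ := fun n => ∑ k ∈ Finset.range n, α k with hD
  have hSlim : Tendsto S atTop (𝓝 (∑' k, c k)) := hc.hasSum.tendsto_sum_nat
  have hSle : ∀ n, S n ≤ ∑' k, c k := fun n => hc.sum_le_tsum _ fun k _ => hc0 k
  have hSmono : Monotone S := monotone_nat_of_le_succ fun n => by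
    simp only [hS, Finset.sum_range_succ]
    linarith [hc0 n]
  obtain ⟨N, hN⟩ := eventually_atTop.1 ((hβ (ε / 3) (by positivity)).and
    (hSlim.eventually_const_lt (show ∑' k, c k - ε / 3 < ∑' k, c k by linarith)))
  have hNS := (hN N le_rfl).2
  set K := |a N| with hK
  -- Once the forcing level `ε / 3` and the accumulated errors are removed, what is left shrinks by
  -- `1 - α n ≤ exp (-α n)` at each step.
  have hbound : ∀ n, N ≤ n →
      a n - ε / 3 - (S n - S N) ≤ Real.exp (-(D n - D N)) * K := by
    intro n hn
    induction n, hn using Nat.le_induction with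
    | base =>
      simp only [sub_self, neg_zero, Real.exp_zero, one_mul, sub_zero]
      linarith [le_abs_self (a N)]
    | succ n hn ih =>
      have e1 : S (n + 1) = S n + c n := Finset.sum_range_succ _ _
      have e2 : D (n + 1) = D n + α n := Finset.sum_range_succ _ _
      have e3 : Real.exp (-(D (n + 1) - D N)) = Real.exp (-α n) * Real.exp (-(D n - D N)) := by
        rw [← Real.exp_add, e2]
        ring_nf
      have h1 := h n
      have h2 := mul_le_mul_of_nonneg_left (hN n hn).1 (hα n).1
      have h3 := mul_nonneg (hα n).1 (sub_nonneg.2 (hSmono hn))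
      have h4 := mul_le_mul_of_nonneg_left ih (sub_nonneg.2 (hα n).2)
      have h5 : (1 - α n) * (Real.exp (-(D n - D N)) * K) ≤
          Real.exp (-α n) * (Real.exp (-(D n - D N)) * K) :=
        mul_le_mul_of_nonneg_right (Real.one_sub_le_exp_neg _) (by positivity)
      rw [e3, e1, mul_assoc]
      linarith
  have hexp : Tendsto (fun n => Real.exp (-(D n - D N)) * K) atTop (𝓝 0) := by
    have h1 : Tendsto (fun n => D n - D N) atTop atTop :=
      tendsto_atTop_add_const_right _ (-D N) hdiv
    simpa using (Real.tendsto_exp_neg_atTop_nhds_zero.comp h1).mul_const K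
  obtain ⟨N', hN'⟩ := eventually_atTop.1
    (hexp.eventually_lt_const (show (0 : ℝ) < ε / 3 by positivity))
  refine ⟨max N N', fun n hn => ?_⟩
  have h1 := hbound n (le_of_max_le_left hn)
  have h2 := hN' n (le_of_max_le_right hn)
  have h3 := hSle n
  rw [Real.dist_eq, sub_zero, abs_of_nonneg (ha n)]
  linarith

/-! ### Regularized iterations of nonexpansive maps -/

section Nonexpansive

variable {H : Type*} [NormedAddCommGroup H] [InnerProductSpace ℝ H]

/-- By Cauchy–Schwarz, `Id - T` is monotone. -/
lemma inner_displacement_nonpos {T : H → H} (hT : ∀ v w, ‖T v - T w‖ ≤ ‖v - w‖) (v w : H) :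
    inner ℝ ((T v - v) - (T w - w)) (v - w) ≤ 0 := by
  have h1 : inner ℝ (T v - T w) (v - w) ≤ ‖v - w‖ * ‖v - w‖ :=
    (real_inner_le_norm _ _).trans (mul_le_mul_of_nonneg_right (hT v w) (norm_nonneg _))
  have e1 : (T v - v) - (T w - w) = (T v - T w) - (v - w) := by abel
  rw [e1, inner_sub_left, real_inner_self_eq_norm_mul_norm]
  linarith

/-- A scaled nonexpansive map `(1 + s)⁻¹ • T` has a fixed point. -/
lemma exists_displacement_eq_smul [CompleteSpace H] {T : H → H}
    (hT : ∀ v w, ‖T v - T w‖ ≤ ‖v - w‖) {s : ℝ} (hs : 0 < s) : ∃ w, T w - w = s • w := by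
  have hpos : (0 : ℝ) < 1 + s := by linarith
  have hcon : ContractingWith (Real.toNNReal (1 + s)⁻¹)
      (fun w => (1 + s)⁻¹ • T w) := by
    refine ⟨?_, LipschitzWith.of_dist_le_mul fun v w => ?_⟩
    · rw [Real.toNNReal_lt_one]
      exact inv_lt_one_of_one_lt₀ (by linarith)
    · rw [dist_eq_norm, dist_eq_norm, ← smul_sub, norm_smul, Real.norm_eq_abs,
        abs_of_pos (inv_pos.2 hpos), Real.coe_toNNReal _ (inv_pos.2 hpos).le]
      exact mul_le_mul_of_nonneg_left (hT v w) (inv_pos.2 hpos).le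
  obtain ⟨w, hw⟩ : ∃ w, (1 + s)⁻¹ • T w = w := ⟨_, hcon.fixedPoint_isFixedPt⟩
  refine ⟨w, ?_⟩
  have h1 : T w = (1 + s) • w := by
    conv_rhs => rw [← hw]
    rw [smul_inv_smul₀ hpos.ne']
  rw [h1, add_smul, one_smul, add_sub_cancel_left]

/-- Browder's approximating path converges to a fixed point, which satisfies the variational
inequality that characterizes the fixed point of least norm. -/
lemma exists_path_tendsto_fixedPoint [CompleteSpace H] {T : H → H}
    (hT : ∀ v w, ‖T v - T w‖ ≤ ‖v - w‖) {p : H} (hp : T p = p) :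
    ∃ (w : ℕ → H) (q : H), (∀ k, T (w k) - w k = (1 / ((k : ℝ) + 1)) • w k) ∧
      Tendsto w atTop (𝓝 q) ∧ T q = q ∧ ∀ p', T p' = p' → inner ℝ q (q - p') ≤ 0 := by
  choose w hw using fun k : ℕ =>
    exists_displacement_eq_smul hT (s := 1 / ((k : ℝ) + 1)) Nat.one_div_pos_of_nat
  have hvar : ∀ p', T p' = p' → ∀ k, inner ℝ (w k) (w k - p') ≤ 0 := by
    intro p' hp' k
    have h := inner_displacement_nonpos hT (w k) p'
    rw [hw, hp', sub_self, sub_zero, real_inner_smul_left] at h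
    exact nonpos_of_mul_nonpos_right h Nat.one_div_pos_of_nat
  -- As the parameters `1 / (k + 1)` decrease, monotonicity gives `⟪w k, w k - w l⟫ ≤ 0`. Squared
  -- distances are thus bounded by increments of the bounded sequence `‖w k‖²`, so `w` is Cauchy.
  have hstep : ∀ k l, k ≤ l → ‖w k‖ ^ 2 + ‖w l - w k‖ ^ 2 ≤ ‖w l‖ ^ 2 := by
    intro k l hkl
    rcases hkl.eq_or_lt with rfl | hlt
    · simp
    have h := inner_displacement_nonpos hT (w k) (w l)
    have hs : 1 / ((l : ℝ) + 1) < 1 / ((k : ℝ) + 1) := Nat.one_div_lt_one_div hlt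
    have hs0 : 0 < 1 / ((l : ℝ) + 1) := Nat.one_div_pos_of_nat
    rw [hw, hw] at h
    set s := 1 / ((k : ℝ) + 1)
    set s' := 1 / ((l : ℝ) + 1)
    have e1 : s • w k - s' • w l = (s - s') • w k + s' • (w k - w l) := by
      rw [sub_smul, smul_sub]
      abel
    rw [e1, inner_add_left, real_inner_smul_left, real_inner_smul_left,
      real_inner_self_eq_norm_sq] at h
    have h1 : inner ℝ (w k) (w k - w l) ≤ 0 := by
      refine nonpos_of_mul_nonpos_right (a := s - s') ?_ (sub_pos.2 hs)
      nlinarith [mul_nonneg hs0.le (sq_nonneg ‖w k - w l‖)]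
    rw [norm_sub_sq_real]
    rw [inner_sub_right, real_inner_self_eq_norm_sq, real_inner_comm] at h1
    linarith
  have hmono : Monotone fun k => ‖w k‖ ^ 2 := fun k l hkl => by
    nlinarith [hstep k l hkl, sq_nonneg ‖w l - w k‖]
  have hbdd : BddAbove (Set.range fun k => ‖w k‖ ^ 2) := by
    refine ⟨‖p‖ ^ 2, ?_⟩
    rintro _ ⟨k, rfl⟩
    have h := hvar p hp k
    rw [inner_sub_right, real_inner_self_eq_norm_sq] at h
    have h2 := norm_sub_sq_real (w k) p
    simp only
    nlinarith [sq_nonneg ‖w k - p‖]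
  have hlim := tendsto_atTop_ciSup hmono hbdd
  set m := ⨆ k, ‖w k‖ ^ 2
  have hcau : CauchySeq w := by
    refine cauchySeq_of_le_tendsto_0' (fun k => √(m - ‖w k‖ ^ 2)) (fun k l hkl => ?_) ?_
    · rw [dist_comm, dist_eq_norm]
      refine Real.le_sqrt_of_sq_le ?_
      have : ‖w l‖ ^ 2 ≤ m := le_ciSup hbdd l
      linarith [hstep k l hkl]
    · simpa using (hlim.const_sub m).sqrt
  obtain ⟨q, hq⟩ := cauchySeq_tendsto_of_complete hcau
  have hcont : Continuous T := (LipschitzWith.of_dist_le_mul (K := 1) fun x y => by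
    simpa [dist_eq_norm] using hT x y).continuous
  refine ⟨w, q, hw, hq, ?_, fun p' hp' => ?_⟩
  · have h1 : Tendsto (fun k => T (w k) - w k) atTop (𝓝 (T q - q)) :=
      ((hcont.tendsto q).comp hq).sub hq
    have h2 : Tendsto (fun k => T (w k) - w k) atTop (𝓝 0) := by
      simp only [hw]
      simpa using (tendsto_one_div_add_atTop_nhds_zero_nat (𝕜 := ℝ)).smul hq
    exact sub_eq_zero.1 (tendsto_nhds_unique h1 h2)
  · exact le_of_tendsto' (hq.inner (hq.sub tendsto_const_nhds)) (hvar p' hp')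

lemma proj_zero_eq_singleton {C : Set H} {q : H} (hq : q ∈ C)
    (h : ∀ p ∈ C, inner ℝ q (q - p) ≤ 0) : SetOp.proj C 0 = {q} := by
  have hkey : ∀ p ∈ C, ‖q‖ ^ 2 + ‖p - q‖ ^ 2 ≤ ‖p‖ ^ 2 := by
    intro p hp
    have h1 := h p hp
    rw [inner_sub_right, real_inner_self_eq_norm_sq] at h1
    rw [norm_sub_sq_real, real_inner_comm]
    linarith
  ext p
  simp only [SetOp.proj, zero_sub, norm_neg, Set.mem_ofPred_eq, Set.mem_singleton_iff]
  constructor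
  · rintro ⟨hp, hmin⟩
    have h1 := hkey p hp
    have h2 := pow_le_pow_left₀ (norm_nonneg p) (hmin q hq) 2
    have h3 : ‖p - q‖ = 0 := by nlinarith [norm_nonneg (p - q)]
    exact sub_eq_zero.1 (norm_eq_zero.1 h3)
  · rintro rfl
    refine ⟨hq, fun z hz => le_of_sq_le_sq ?_ (norm_nonneg _)⟩
    nlinarith [hkey z hz, sq_nonneg ‖z - p‖]

/-- Asymptotic fixed points of `T` satisfy, in the limit, the variational inequality of the limit
of Browder's path. -/
lemma eventually_inner_le_of_displacement_tendsto_zero {T : H → H}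
    (hT : ∀ v w, ‖T v - T w‖ ≤ ‖v - w‖) {v : ℕ → H} {q : H}
    (hv : ∀ k, T (v k) - v k = (1 / ((k : ℝ) + 1)) • v k) (hvq : Tendsto v atTop (𝓝 q))
    {w : ℕ → H} {M : ℝ} (hM : ∀ n, ‖w n - q‖ ≤ M)
    (hw : Tendsto (fun n => T (w n) - w n) atTop (𝓝 0)) {ε : ℝ} (hε : 0 < ε) :
    ∀ᶠ n in atTop, inner ℝ q (q - w n) ≤ ε := by
  have hsmall : Tendsto (fun k => ‖q - v k‖ * M + ‖v k‖ * ‖q - v k‖) atTop (𝓝 0) := by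
    have h1 : Tendsto (fun k => ‖q - v k‖) atTop (𝓝 0) := by
      simpa using (hvq.const_sub q).norm
    simpa using (h1.mul_const M).add (hvq.norm.mul h1)
  -- Fix a path point close to `q` before letting `n` grow: dividing by `s` is harmless only for
  -- fixed `k`.
  obtain ⟨k, hk⟩ := (hsmall.eventually_lt_const (half_pos hε)).exists
  set s := 1 / ((k : ℝ) + 1) with hs
  have hs0 : 0 < s := Nat.one_div_pos_of_nat
  have hlim : Tendsto (fun n => ‖T (w n) - w n‖ * (M + ‖q - v k‖)) atTop (𝓝 0) := by
    simpa using hw.norm.mul_const (M + ‖q - v k‖)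
  filter_upwards [hlim.eventually_lt_const (mul_pos hs0 (half_pos hε))] with n hn
  have h1 := inner_displacement_nonpos hT (v k) (w n)
  rw [hv, inner_sub_left, real_inner_smul_left] at h1
  have h2 : inner ℝ (T (w n) - w n) (v k - w n) ≤ ‖T (w n) - w n‖ * (M + ‖q - v k‖) := by
    refine (real_inner_le_norm _ _).trans (mul_le_mul_of_nonneg_left ?_ (norm_nonneg _))
    have e1 : v k - w n = -(w n - q) - (q - v k) := by abel
    rw [e1]
    refine (norm_sub_le _ _).trans ?_
    rw [norm_neg]
    linarith [hM n]
  have h3 : inner ℝ (v k) (v k - w n) < ε / 2 :=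
    lt_of_mul_lt_mul_left (by linarith) hs0.le
  have h4 : inner ℝ (q - v k) (q - w n) ≤ ‖q - v k‖ * M := by
    refine (real_inner_le_norm _ _).trans (mul_le_mul_of_nonneg_left ?_ (norm_nonneg _))
    rw [norm_sub_rev]
    exact hM n
  have h5 : inner ℝ (v k) (q - v k) ≤ ‖v k‖ * ‖q - v k‖ := real_inner_le_norm _ _
  have e2 : inner ℝ q (q - w n) = inner ℝ (q - v k) (q - w n) + inner ℝ (v k) (q - v k)
      + inner ℝ (v k) (v k - w n) := by
    simp only [inner_sub_left, inner_sub_right]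
    ring
  linarith

lemma sq_displacement_le {T : H → H} (hT : ∀ v w, ‖T v - T w‖ ≤ ‖v - w‖) {q : H} (hq : T q = q)
    (w : H) {l : ℝ} (h0 : 0 ≤ l) :
    ‖w + l • (T w - w) - q‖ ^ 2 ≤ ‖w - q‖ ^ 2 - l * (1 - l) * ‖T w - w‖ ^ 2 := by
  have h1 : ‖T w - q‖ ≤ ‖w - q‖ := by simpa [hq] using hT w q
  have e1 : w + l • (T w - w) - q = (w - q) + l • ((T w - q) - (w - q)) := by
    rw [sub_sub_sub_cancel_right]
    abel
  have h2 := pow_le_pow_left₀ (norm_nonneg _) h1 2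
  rw [e1, SetOp.norm_sq_add_smul_sub, sub_sub_sub_cancel_right]
  nlinarith [mul_le_mul_of_nonneg_left h2 h0]

lemma norm_relax_sub_relax_le {T : H → H} (hT : ∀ v w, ‖T v - T w‖ ≤ ‖v - w‖) (w w' : H)
    {l l' : ℝ} (h0 : 0 ≤ l') (h1 : l' ≤ 1) :
    ‖(w' + l' • (T w' - w')) - (w + l • (T w - w))‖ ≤ ‖w' - w‖ + |l' - l| * ‖T w - w‖ := by
  have e1 : (w' + l' • (T w' - w')) - (w + l • (T w - w)) =
      ((1 - l') • (w' - w) + l' • (T w' - T w)) + (l' - l) • (T w - w) := by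
    simp only [smul_sub, sub_smul, one_smul]
    abel
  rw [e1]
  refine (norm_add_le _ _).trans (add_le_add ((norm_add_le _ _).trans ?_) ?_)
  · rw [norm_smul, norm_smul, Real.norm_eq_abs, Real.norm_eq_abs, abs_of_nonneg h0,
      abs_of_nonneg (sub_nonneg.2 h1)]
    linarith [mul_le_mul_of_nonneg_left (hT w' w) h0]
  · rw [norm_smul, Real.norm_eq_abs]

/-- Strong convergence, to the fixed point of least norm, of the Tikhonov-regularized iteration
`x (n + 1) = T (w n + l n • (T (w n) - w n))`, `w n = e n • x n`. -/
theorem tendsto_of_regularized_iteration [CompleteSpace H] {T : H → H}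
    (hT : ∀ v w, ‖T v - T w‖ ≤ ‖v - w‖) {p : H} (hp : T p = p) {e l : ℕ → ℝ}
    (he : ∀ n, 0 < e n ∧ e n < 1) (he_lim : Tendsto e atTop (𝓝 1))
    (he_div : Tendsto (fun N => ∑ n ∈ Finset.range N, (1 - e n)) atTop atTop)
    (he_var : Summable fun n => |e (n + 1) - e n|)
    {a b : ℝ} (ha : 0 < a) (hb : b < 1) (hl : ∀ n, a ≤ l n ∧ l n ≤ b)
    (hl_var : Summable fun n => |l (n + 1) - l n|) {x : ℕ → H}
    (hx : ∀ n, x (n + 1) = T (e n • x n + l n • (T (e n • x n) - e n • x n))) :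
    ∃ q, T q = q ∧ (∀ p', T p' = p' → inner ℝ q (q - p') ≤ 0) ∧ Tendsto x atTop (𝓝 q) ∧
      Tendsto (fun n => T (e n • x n) - e n • x n) atTop (𝓝 0) := by
  obtain ⟨v, q, hv, hvq, hq, hvi⟩ := exists_path_tendsto_fixedPoint hT hp
  have hl0 : ∀ n, 0 ≤ l n := fun n => ha.le.trans (hl n).1
  have hl1 : ∀ n, l n ≤ 1 := fun n => (hl n).2.trans hb.le
  set w : ℕ → H := fun n => e n • x n with hw
  set r : ℕ → H := fun n => w n + l n • (T (w n) - w n) with hr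
  have hxr : ∀ n, x (n + 1) = T (r n) := hx
  have hrq : ∀ n, ‖r n - q‖ ^ 2 ≤ ‖w n - q‖ ^ 2 - l n * (1 - l n) * ‖T (w n) - w n‖ ^ 2 :=
    fun n => sq_displacement_le hT hq (w n) (hl0 n)
  have hxq2 : ∀ n, ‖x (n + 1) - q‖ ^ 2 ≤
      ‖w n - q‖ ^ 2 - l n * (1 - l n) * ‖T (w n) - w n‖ ^ 2 := by
    intro n
    refine le_trans (pow_le_pow_left₀ (norm_nonneg _) ?_ 2) (hrq n)
    rw [hxr]
    simpa [hq] using hT (r n) q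
  have hxw : ∀ n, ‖x (n + 1) - q‖ ≤ ‖w n - q‖ := by
    intro n
    refine le_of_sq_le_sq ((hxq2 n).trans ?_) (norm_nonneg _)
    nlinarith [mul_nonneg (mul_nonneg (hl0 n) (sub_nonneg.2 (hl1 n)))
      (sq_nonneg ‖T (w n) - w n‖)]
  have hwe : ∀ n, w n - q = e n • (x n - q) - (1 - e n) • q := by
    intro n
    simp only [hw, smul_sub, sub_smul, one_smul]
    abel
  -- `w n - q` is a convex combination of `x n - q` and `-q`, so the ball of radius `M` is
  -- preserved.
  set M := max ‖x 0 - q‖ ‖q‖ with hM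
  have hqM : ‖q‖ ≤ M := le_max_right _ _
  have hM0 : 0 ≤ M := (norm_nonneg q).trans hqM
  have hwM' : ∀ n, ‖x n - q‖ ≤ M → ‖w n - q‖ ≤ M := by
    intro n hn
    rw [hwe]
    refine (norm_sub_le _ _).trans ?_
    rw [norm_smul, norm_smul, Real.norm_eq_abs, Real.norm_eq_abs, abs_of_pos (he n).1,
      abs_of_pos (sub_pos.2 (he n).2)]
    linarith [mul_le_mul_of_nonneg_left hn (he n).1.le,
      mul_le_mul_of_nonneg_left hqM (sub_pos.2 (he n).2).le]
  have hxM : ∀ n, ‖x n - q‖ ≤ M := by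
    intro n
    induction n with
    | zero => exact le_max_left _ _
    | succ n ih => exact (hxw n).trans (hwM' n ih)
  have hwM : ∀ n, ‖w n - q‖ ≤ M := fun n => hwM' n (hxM n)
  have hx2M : ∀ n, ‖x n‖ ≤ 2 * M := by
    intro n
    have := norm_add_le (x n - q) q
    rw [sub_add_cancel] at this
    linarith [hxM n]
  have hTw : ∀ n, ‖T (w n) - w n‖ ≤ 2 * M := by
    intro n
    have h1 : ‖T (w n) - q‖ ≤ ‖w n - q‖ := by simpa [hq] using hT (w n) q
    have h2 := norm_sub_le (T (w n) - q) (w n - q)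
    rw [sub_sub_sub_cancel_right] at h2
    linarith [hwM n]
  have hreg : Tendsto (fun n => ‖x (n + 1) - x n‖) atTop (𝓝 0) := by
    refine tendsto_zero_of_le_one_sub_mul_add (α := fun n => 1 - e (n + 1)) (β := 0)
      (c := fun n => |e (n + 1) - e n| * (2 * M) + |l (n + 1) - l n| * (2 * M))
      (fun n => norm_nonneg _)
      (fun n => ⟨by linarith [(he (n + 1)).2], by linarith [(he (n + 1)).1]⟩) ?_
      (fun ε hε => Eventually.of_forall fun n => hε.le) (fun n => by positivity)
      ((he_var.mul_right _).add (hl_var.mul_right _)) (fun n => ?_)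
    -- The contraction weight here is `1 - e (n + 1)`; dropping the first term keeps the series
    -- divergent.
    · have h1 := (tendsto_add_atTop_iff_nat 1).2 he_div
      have h2 := tendsto_atTop_add_const_right _ (-(1 - e 0)) h1
      refine h2.congr fun N => ?_
      rw [Finset.sum_range_succ']
      ring
    · have h1 : ‖x (n + 1 + 1) - x (n + 1)‖ ≤ ‖r (n + 1) - r n‖ := by
        rw [hxr, hxr]
        exact hT _ _
      have h2 := norm_relax_sub_relax_le hT (w n) (w (n + 1)) (l := l n) (hl0 (n + 1))
        (hl1 (n + 1))
      have h3 : ‖w (n + 1) - w n‖ ≤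
          e (n + 1) * ‖x (n + 1) - x n‖ + |e (n + 1) - e n| * ‖x n‖ := by
        have e1 : w (n + 1) - w n = e (n + 1) • (x (n + 1) - x n) + (e (n + 1) - e n) • x n := by
          simp only [hw, smul_sub, sub_smul]
          abel
        rw [e1]
        refine (norm_add_le _ _).trans ?_
        rw [norm_smul, norm_smul, Real.norm_eq_abs, Real.norm_eq_abs, abs_of_pos (he (n + 1)).1]
      have h4 := mul_le_mul_of_nonneg_left (hx2M n) (abs_nonneg (e (n + 1) - e n))
      have h5 := mul_le_mul_of_nonneg_left (hTw n) (abs_nonneg (l (n + 1) - l n))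
      simp only [Pi.zero_apply, mul_zero, sub_sub_cancel]
      linarith
  have hdisp : Tendsto (fun n => T (w n) - w n) atTop (𝓝 0) := by
    have hab : 0 < a * (1 - b) := mul_pos ha (sub_pos.2 hb)
    have h1 : ∀ n, ‖T (w n) - w n‖ ^ 2 ≤
        (a * (1 - b))⁻¹ * (2 * M * ((1 - e n) * (2 * M) + ‖x (n + 1) - x n‖)) := by
      intro n
      rw [← div_eq_inv_mul, le_div_iff₀ hab]
      have h2 : ‖w n - q‖ - ‖x (n + 1) - q‖ ≤ (1 - e n) * (2 * M) + ‖x (n + 1) - x n‖ := by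
        have e1 : w n - q = (x (n + 1) - q) - (1 - e n) • x n - (x (n + 1) - x n) := by
          simp only [hw, sub_smul, one_smul]
          abel
        have h3 := norm_sub_le ((x (n + 1) - q) - (1 - e n) • x n) (x (n + 1) - x n)
        have h4 := norm_sub_le (x (n + 1) - q) ((1 - e n) • x n)
        rw [← e1] at h3
        rw [norm_smul, Real.norm_eq_abs, abs_of_pos (sub_pos.2 (he n).2)] at h4
        linarith [mul_le_mul_of_nonneg_left (hx2M n) (sub_pos.2 (he n).2).le]
      have h5 : a * (1 - b) ≤ l n * (1 - l n) :=
        mul_le_mul (hl n).1 (by linarith [(hl n).2]) (sub_pos.2 hb).le (hl0 n)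
      have h6 := mul_le_mul_of_nonneg_right h5 (sq_nonneg ‖T (w n) - w n‖)
      -- The loss is at most a difference of squares, factored as a bounded sum times a difference
      -- that vanishes in the limit.
      have h7 : (‖w n - q‖ + ‖x (n + 1) - q‖) * (‖w n - q‖ - ‖x (n + 1) - q‖) ≤
          2 * M * ((1 - e n) * (2 * M) + ‖x (n + 1) - x n‖) :=
        mul_le_mul (by linarith [hwM n, hxM (n + 1)]) h2 (sub_nonneg.2 (hxw n)) (by positivity)
      linarith [hxq2 n]
    have h2 : Tendsto (fun n => (a * (1 - b))⁻¹ *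
        (2 * M * ((1 - e n) * (2 * M) + ‖x (n + 1) - x n‖))) atTop (𝓝 0) := by
      have h3 := ((((he_lim.const_sub 1).mul_const (2 * M)).add hreg).const_mul
        (2 * M)).const_mul (a * (1 - b))⁻¹
      simpa using h3
    have h4 := (squeeze_zero (fun n => sq_nonneg _) h1 h2).sqrt
    refine tendsto_zero_iff_norm_tendsto_zero.2 ?_
    simpa [Real.sqrt_sq] using h4
  refine ⟨q, hq, hvi, ?_, hdisp⟩
  have hsq : Tendsto (fun n => ‖x n - q‖ ^ 2) atTop (𝓝 0) := by
    refine tendsto_zero_of_le_one_sub_mul_add (α := fun n => 1 - e n)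
      (β := fun n => 2 * inner ℝ q (q - w n)) (c := 0) (fun n => sq_nonneg _)
      (fun n => ⟨by linarith [(he n).2], by linarith [(he n).1]⟩) he_div (fun ε hε => ?_)
      (fun n => le_rfl) summable_zero (fun n => ?_)
    · filter_upwards [eventually_inner_le_of_displacement_tendsto_zero hT hv hvq hwM hdisp
        (half_pos hε)] with n hn
      linarith
    -- Expanding `e n • (x n - q) = (w n - q) + (1 - e n) • q` and dropping `‖(1 - e n) • q‖²`
    -- leaves `β n = 2 ⟪q, q - w n⟫`.
    · have h1 : ‖e n • (x n - q)‖ ^ 2 ≤ e n * ‖x n - q‖ ^ 2 := by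
        rw [norm_smul, mul_pow, Real.norm_eq_abs, sq_abs]
        exact mul_le_mul_of_nonneg_right (by nlinarith [(he n).1, (he n).2]) (sq_nonneg _)
      have h2 := pow_le_pow_left₀ (norm_nonneg _) (hxw n) 2
      have e1 : e n • (x n - q) = (w n - q) + (1 - e n) • q := by
        rw [hwe]
        abel
      rw [e1, norm_add_sq_real, real_inner_smul_right] at h1
      have e2 : inner ℝ q (q - w n) = -inner ℝ (w n - q) q := by
        rw [real_inner_comm, ← neg_sub, inner_neg_left]
      simp only [Pi.zero_apply, e2]
      nlinarith [sq_nonneg ‖(1 - e n) • q‖]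
  rw [tendsto_iff_norm_sub_tendsto_zero]
  simpa [Real.sqrt_sq] using hsq.sqrt

end Nonexpansive

/-! ### Fixed points of the composed reflections and zeros of the sum -/

namespace SetOp

variable {H : Type*} [NormedAddCommGroup H] [InnerProductSpace ℝ H]

lemma reflectedResolvent_comp_apply (A B : SetOp H) (w : H) :
    reflectedResolvent A (reflectedResolvent B w) =
      w + (2 : ℝ) • (resolvent A ((2 : ℝ) • resolvent B w - w) - resolvent B w) := by
  simp only [reflectedResolvent, smul_sub]
  abel

lemma exists_fixedPoint_of_zer_nonempty [CompleteSpace H] {A B : SetOp H}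
    (hA : A.IsMaximallyMonotone) (hB : B.IsMaximallyMonotone) (h : (zer (A + B)).Nonempty)
    {γ : ℝ} (hγ : 0 < γ) :
    ∃ p, reflectedResolvent (γ • A) (reflectedResolvent (γ • B) p) = p := by
  obtain ⟨x, a, ha, b, hb, hab⟩ := h
  have hba : a = -b := eq_neg_of_add_eq_zero_left hab
  have h1 : resolvent (γ • B) (x + γ • b) = x :=
    (hB.smul hγ).resolvent_eq ((mem_smul_iff hγ).2 (by simpa [hγ.ne'] using hb))
  have h2 : resolvent (γ • A) ((2 : ℝ) • x - (x + γ • b)) = x := by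
    refine (hA.smul hγ).resolvent_eq ((mem_smul_iff hγ).2 ?_)
    have e1 : (2 : ℝ) • x - (x + γ • b) - x = γ • a := by
      rw [hba, two_smul, smul_neg]
      abel
    rw [e1, inv_smul_smul₀ hγ.ne']
    exact ha
  -- With `b ∈ B x` and `-b ∈ A x`, both resolvents return `x`, so the displacement vanishes.
  refine ⟨x + γ • b, ?_⟩
  rw [reflectedResolvent_comp_apply, h1, h2, sub_self, smul_zero, add_zero]

/-- At a fixed point both resolvents return the same `y`, with residuals `q - y ∈ γ B y` and `y - q
∈ γ A y`, which cancel. -/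
lemma resolvent_mem_zer [CompleteSpace H] {A B : SetOp H}
    (hA : A.IsMaximallyMonotone) (hB : B.IsMaximallyMonotone) {γ : ℝ} (hγ : 0 < γ) {q : H}
    (hq : reflectedResolvent (γ • A) (reflectedResolvent (γ • B) q) = q) :
    resolvent (γ • B) q ∈ zer (A + B) := by
  rw [reflectedResolvent_comp_apply, add_eq_left, smul_eq_zero_iff_right two_ne_zero,
    sub_eq_zero] at hq
  have h1 := (mem_smul_iff hγ).1 ((hB.smul hγ).sub_resolvent_mem q)
  have h2 := (mem_smul_iff hγ).1
    ((hA.smul hγ).sub_resolvent_mem ((2 : ℝ) • resolvent (γ • B) q - q))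
  rw [hq] at h2
  refine ⟨_, h2, _, h1, ?_⟩
  simp only
  rw [← smul_add, two_smul]
  convert smul_zero γ⁻¹ using 2
  abel

end SetOp

theorem theoremT5p1 {H : Type*} [NormedAddCommGroup H] [InnerProductSpace ℝ H] [CompleteSpace H]
    (A B : SetOp H) (hA : A.IsMaximallyMonotone) (hB : B.IsMaximallyMonotone)
    (hzer : (SetOp.zer (A + B)).Nonempty)
    (γ : ℝ) (hγ : 0 < γ)
    (e θ : ℕ → ℝ)
    (he : ∀ n, 0 < e n ∧ e n < 1)
    (he_lim : Tendsto e atTop (𝓝 1))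
    (he_div : Tendsto (fun N => ∑ n ∈ Finset.range N, (1 - e n)) atTop atTop)
    (he_var : Summable fun n => |e (n + 1) - e n|)
    (θlow θup : ℝ) (hθlow : 0 < θlow) (hθup : θup < 1)
    (hθ : ∀ n, θlow ≤ θ n / 2 ∧ θ n / 2 ≤ θup)
    (hθ_var : Summable fun n => |θ (n + 1) - θ n|)
    (x y z u : ℕ → H)
    (hy : ∀ n, y n = SetOp.resolvent (γ • B) (e n • x n))
    (hz : ∀ n, z n = SetOp.resolvent (γ • A) ((2 : ℝ) • y n - e n • x n))
    (hu : ∀ n, u n = e n • x n + θ n • (z n - y n))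
    (hx : ∀ n, x (n + 1) =
      SetOp.reflectedResolvent (γ • A) (SetOp.reflectedResolvent (γ • B) (u n))) :
    ∃ xbar : H,
      SetOp.proj (Function.fixedPoints
        (SetOp.reflectedResolvent (γ • A) ∘ SetOp.reflectedResolvent (γ • B))) 0 = {xbar} ∧
      Tendsto x atTop (𝓝 xbar) ∧
      Tendsto y atTop (𝓝 (SetOp.resolvent (γ • B) xbar)) ∧
      Tendsto z atTop (𝓝 (SetOp.resolvent (γ • B) xbar)) ∧
      SetOp.resolvent (γ • B) xbar ∈ SetOp.zer (A + B) := by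
  have hA' := hA.smul hγ
  have hB' := hB.smul hγ
  set T : H → H := SetOp.reflectedResolvent (γ • A) ∘ SetOp.reflectedResolvent (γ • B) with hTdef
  have hT : ∀ v w, ‖T v - T w‖ ≤ ‖v - w‖ := fun v w =>
    (hA'.norm_reflectedResolvent_sub_le _ _).trans (hB'.norm_reflectedResolvent_sub_le v w)
  have hTw : ∀ n, T (e n • x n) - e n • x n = (2 : ℝ) • (z n - y n) := fun n => by
    rw [hTdef, Function.comp_apply, SetOp.reflectedResolvent_comp_apply, ← hy, ← hz,
      add_sub_cancel_left]
  obtain ⟨p, hp⟩ := SetOp.exists_fixedPoint_of_zer_nonempty hA hB hzer hγ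
  -- The relaxation parameter is `θ n / 2`, since the displacement of `T` is twice `z n - y n`.
  obtain ⟨q, hq, hvi, hxq, hdisp⟩ := tendsto_of_regularized_iteration hT hp he he_lim he_div he_var
    hθlow hθup hθ (by
      refine (hθ_var.div_const 2).congr fun n => ?_
      rw [← sub_div, abs_div, abs_two]) (x := x) (fun n => by
      rw [hTw, smul_smul, div_mul_cancel₀ _ (two_ne_zero' ℝ), ← hu, hx]
      rfl)
  have hwq : Tendsto (fun n => e n • x n) atTop (𝓝 q) := by
    simpa using he_lim.smul hxq
  have hyq : Tendsto y atTop (𝓝 (SetOp.resolvent (γ • B) q)) :=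
    ((hB'.continuous_resolvent.tendsto q).comp hwq).congr fun n => (hy n).symm
  refine ⟨q, proj_zero_eq_singleton hq hvi, hxq, hyq, ?_, SetOp.resolvent_mem_zer hA hB hγ hq⟩
  have hzy : Tendsto (fun n => y n + (2 : ℝ)⁻¹ • (T (e n • x n) - e n • x n)) atTop
      (𝓝 (SetOp.resolvent (γ • B) q)) := by
    simpa using hyq.add (hdisp.const_smul (2 : ℝ)⁻¹)
  refine hzy.congr fun n => ?_
  rw [hTw, inv_smul_smul₀ two_ne_zero, add_sub_cancel]
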